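/- Let $R$ be a commutative noetherian ring, $\mathfrak{a}$ an ideal of $R$, $M$ an arbitrary $R$-module and $n\ge 0$ an integer. For an $R$-module $N$ let $\Gamma_{\mathfrak{a}}(N)=\{x\in N : \mathfrak{a}^k x=0 \text{ for some } k\ge 0\}$, and let $H^i_{\mathfrak{a}}$ be the $i$-th right derived functor of $\Gamma_{\mathfrak{a}}$. Let $$f:\operatorname{Ext}^n_R(R/\mathfrak{a},M)\longrightarrow \operatorname{Hom}_R(R/\mathfrak{a},H^n_{\mathfrak{a}}(M))$$ be the natural $R$-homomorphism: if $I^\bullet$ is an injective resolution of $M$ and a class $e\in\operatorname{Ext}^n_R(R/\mathfrak{a},M)=H^n(\operatorname{Hom}_R(R/\mathfrak{a},I^\bullet))$ is represented by $\varphi:R/\mathfrak{a}\to I^n$ with $d\varphi=0$, then $\varphi$ has image in $\Gamma_{\mathfrak{a}}(I^n)$ and $f(e)$ sends $x$ to the class of $\varphi(x)$ in $H^n(\Gamma_{\mathfrak{a}}(I^\bullet))=H^n_{\mathfrak{a}}(M)$. (a) If $\operatorname{Ext}^{n-j}_R(R/\mathfrak{a},H^j_{\mathfrak{a}}(M))=0$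 for all integers $0\le j<n$, then $f$ is injective. (b) If $\operatorname{Ext}^{n+1-j}_R(R/\mathfrak{a},H^j_{\mathfrak{a}}(M))=0$ for all integers $0\le j<n$, then $f$ is surjective. (c) If $\operatorname{Ext}^{t-j}_R(R/\mathfrak{a},H^j_{\mathfrak{a}}(M))=0$ for $t=n,n+1$ and all integers $0\le j<n$, then $f$ is an isomorphism. -/

import Mathlib

open CategoryTheory
open CategoryTheory.Abelian (Ext)

universe u

namespace LocalCoh

noncomputable section

/-- The `𝔞`-torsion submodule `Γ_𝔞(N) = {x ∈ N | 𝔞 ^ k x = 0 for some k}` of an `R`-module `N`. -/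
def torsion {R : Type u} [CommRing R] (a : Ideal R) (N : Type u) [AddCommGroup N] [Module R N] :
    Submodule R N where
  carrier := {x | ∃ k : ℕ, ∀ r ∈ a ^ k, r • x = 0}
  zero_mem' := ⟨0, fun r _ => smul_zero r⟩
  add_mem' := by
    rintro x y ⟨k, hk⟩ ⟨l, hl⟩
    refine ⟨max k l, fun r hr => ?_⟩
    rw [smul_add, hk r (Ideal.pow_le_pow_right (le_max_left k l) hr),
      hl r (Ideal.pow_le_pow_right (le_max_right k l) hr), add_zero]
  smul_mem' := by
    rintro c x ⟨k, hk⟩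
    exact ⟨k, fun r hr => by rw [smul_comm, hk r hr, smul_zero]⟩

lemma torsion_le_comap {R : Type u} [CommRing R] (a : Ideal R) {N P : Type u} [AddCommGroup N]
    [Module R N] [AddCommGroup P] [Module R P] (g : N →ₗ[R] P) :
    torsion a N ≤ (torsion a P).comap g := by
  rintro x ⟨k, hk⟩
  exact ⟨k, fun r hr => by rw [← map_smul, hk r hr, map_zero]⟩

/-- The `𝔞`-torsion functor `Γ_𝔞` on `R`-modules, acting on maps by restriction. -/
def torsionFunctor {R : Type u} [CommRing R] (a : Ideal R) :
    ModuleCat.{u} R ⥤ ModuleCat.{u} R where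
  obj N := ModuleCat.of R (torsion a N)
  map g := ModuleCat.ofHom (g.hom.restrict (torsion_le_comap a g.hom))

instance torsionFunctor_additive {R : Type u} [CommRing R] (a : Ideal R) :
    (torsionFunctor a).Additive where
  map_add := rfl

/-- The local cohomology module `H^n_𝔞(M)`: the value at `M` of the `n`-th right derived functor
of the `𝔞`-torsion functor `Γ_𝔞`. -/
abbrev localCohomologyModule {R : Type u} [CommRing R] (a : Ideal R) (n : ℕ) (M : ModuleCat.{u} R) :
    ModuleCat.{u} R :=
  ((torsionFunctor a).rightDerived n).obj M

/-- The `R`-module `R/𝔞`. -/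
abbrev quotientModule {R : Type u} [CommRing R] (a : Ideal R) : ModuleCat.{u} R :=
  ModuleCat.of R (R ⧸ a)

lemma mem_torsion_of_hom {R : Type u} [CommRing R] (a : Ideal R) {N : ModuleCat.{u} R}
    (φ : quotientModule a ⟶ N) (x : R ⧸ a) : φ.hom x ∈ torsion a N := by
  refine ⟨1, fun r hr => ?_⟩
  rw [pow_one] at hr
  obtain ⟨s, rfl⟩ := Ideal.Quotient.mk_surjective x
  have h : r • (Ideal.Quotient.mk a s) = 0 := by
    rw [← Ideal.Quotient.mk_eq_mk, ← Submodule.Quotient.mk_smul, Submodule.Quotient.mk_eq_zero]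
    exact a.mul_mem_right s hr
  rw [← map_smul, h, map_zero]

/-- A homomorphism `R/𝔞 → N` takes its values in `Γ_𝔞(N)`; this is the induced homomorphism
`R/𝔞 → Γ_𝔞(N)`. -/
def toTorsion {R : Type u} [CommRing R] (a : Ideal R) {N : ModuleCat.{u} R}
    (φ : quotientModule a ⟶ N) : quotientModule a ⟶ (torsionFunctor a).obj N :=
  ModuleCat.ofHom (φ.hom.codRestrict (torsion a N) (mem_torsion_of_hom a φ))

lemma toTorsion_add {R : Type u} [CommRing R] (a : Ideal R) {N : ModuleCat.{u} R}
    (φ ψ : quotientModule a ⟶ N) : toTorsion a (φ + ψ) = toTorsion a φ + toTorsion a ψ := rfl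

lemma toTorsion_smul {R : Type u} [CommRing R] (a : Ideal R) {N : ModuleCat.{u} R} (r : R)
    (φ : quotientModule a ⟶ N) : toTorsion a (r • φ) = r • toTorsion a φ := rfl

lemma toTorsion_comp {R : Type u} [CommRing R] (a : Ideal R) {N P : ModuleCat.{u} R}
    (φ : quotientModule a ⟶ N) (g : N ⟶ P) :
    toTorsion a φ ≫ (torsionFunctor a).map g = toTorsion a (φ ≫ g) := rfl

/-- The complex `Γ_𝔞(K)`, for a cochain complex `K` of `R`-modules. -/
abbrev torsionComplex {R : Type u} [CommRing R] (a : Ideal R)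
    (K : CochainComplex (ModuleCat.{u} R) ℕ) : CochainComplex (ModuleCat.{u} R) ℕ :=
  ((torsionFunctor a).mapHomologicalComplex (ComplexShape.up ℕ)).obj K

/-- `toTorsion` with values in a term of a complex `Γ_𝔞(K)`. -/
def toTorsionComplex {R : Type u} [CommRing R] (a : Ideal R)
    (K : CochainComplex (ModuleCat.{u} R) ℕ) {n : ℕ} (φ : quotientModule a ⟶ K.X n) : quotientModule a ⟶ (torsionComplex a K).X n :=
  toTorsion a φ

lemma toTorsionComplex_d {R : Type u} [CommRing R] (a : Ideal R)
    (K : CochainComplex (ModuleCat.{u} R) ℕ) {n m : ℕ} (φ : quotientModule a ⟶ K.X n) :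
    toTorsionComplex a K φ ≫ (torsionComplex a K).d n m = toTorsionComplex a K (φ ≫ K.d n m) := rfl

lemma toTorsionComplex_d_eq_zero {R : Type u} [CommRing R] (a : Ideal R)
    (K : CochainComplex (ModuleCat.{u} R) ℕ) {n m : ℕ} (φ : quotientModule a ⟶ K.X n)
    (h : φ ≫ K.d n m = 0) : toTorsionComplex a K φ ≫ (torsionComplex a K).d n m = 0 := by
  rw [toTorsionComplex_d, h]
  rfl

/-- Local cohomology is computed by every injective resolution `I` of `M`:
`H^n_𝔞(M) ≅ H^n(Γ_𝔞(I))`. -/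
def localCohomologyIso {R : Type u} [CommRing R] (a : Ideal R) {M : ModuleCat.{u} R}
    (I : InjectiveResolution M) (n : ℕ) :
    localCohomologyModule a n M ≅ (torsionComplex a I.cocomplex).homology n :=
  I.isoRightDerivedObj (torsionFunctor a) n

/-- The homomorphism `R/𝔞 → H^n(Γ_𝔞(I)) ≅ H^n_𝔞(M)` obtained from an injective resolution `I` of
`M` and a homomorphism `φ : R/𝔞 → I^n` with `d ∘ φ = 0`: the homomorphism `φ` takes its values in
the `n`-cocycles of `Γ_𝔞(I)`, and `x` is sent to the cohomology class of `φ(x)`. -/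
def cocycleMap {R : Type u} [CommRing R] (a : Ideal R) {M : ModuleCat.{u} R}
    (I : InjectiveResolution M) (n : ℕ) (φ : quotientModule a ⟶ I.cocomplex.X n)
    (hφ : φ ≫ I.cocomplex.d n (n + 1) = 0) :
    quotientModule a ⟶ localCohomologyModule a n M :=
  ((torsionComplex a I.cocomplex).liftCycles (toTorsionComplex a I.cocomplex φ) (n + 1) (by simp)
      (toTorsionComplex_d_eq_zero a I.cocomplex φ hφ) ≫
    (torsionComplex a I.cocomplex).homologyπ n) ≫ (localCohomologyIso a I n).inv

lemma cocycleMap_add {R : Type u} [CommRing R] (a : Ideal R) {M : ModuleCat.{u} R}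
    (I : InjectiveResolution M) (n : ℕ) (φ ψ : quotientModule a ⟶ I.cocomplex.X n)
    (hφ : φ ≫ I.cocomplex.d n (n + 1) = 0) (hψ : ψ ≫ I.cocomplex.d n (n + 1) = 0)
    (h : (φ + ψ) ≫ I.cocomplex.d n (n + 1) = 0) :
    cocycleMap a I n (φ + ψ) h = cocycleMap a I n φ hφ + cocycleMap a I n ψ hψ := by
  unfold cocycleMap
  rw [← Preadditive.add_comp, ← Preadditive.add_comp]
  congr 2
  rw [← cancel_mono (HomologicalComplex.iCycles _ n), Preadditive.add_comp]
  simp only [HomologicalComplex.liftCycles_i]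
  rfl

lemma cocycleMap_smul {R : Type u} [CommRing R] (a : Ideal R) {M : ModuleCat.{u} R}
    (I : InjectiveResolution M) (n : ℕ) (r : R) (φ : quotientModule a ⟶ I.cocomplex.X n)
    (hφ : φ ≫ I.cocomplex.d n (n + 1) = 0)
    (h : (r • φ) ≫ I.cocomplex.d n (n + 1) = 0) :
    cocycleMap a I n (r • φ) h = r • cocycleMap a I n φ hφ := by
  unfold cocycleMap
  rw [← Linear.smul_comp, ← Linear.smul_comp]
  congr 2
  rw [← cancel_mono (HomologicalComplex.iCycles _ n), Linear.smul_comp]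
  simp only [HomologicalComplex.liftCycles_i]
  rfl

lemma cocycleMap_boundary {R : Type u} [CommRing R] (a : Ideal R) {M : ModuleCat.{u} R}
    (I : InjectiveResolution M) (p : ℕ) (g : quotientModule a ⟶ I.cocomplex.X p)
    (h : (g ≫ I.cocomplex.d p (p + 1)) ≫ I.cocomplex.d (p + 1) (p + 1 + 1) = 0) :
    cocycleMap a I (p + 1) (g ≫ I.cocomplex.d p (p + 1)) h = 0 := by
  unfold cocycleMap
  rw [HomologicalComplex.liftCycles_homologyπ_eq_zero_of_boundary _ _ _ _
    (i' := p) (toTorsionComplex a _ g) (toTorsionComplex_d a _ g).symm]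
  exact Limits.zero_comp

lemma extMk_zero_degree_eq_zero {R : Type u} [CommRing R] {M X : ModuleCat.{u} R}
    (I : InjectiveResolution M) (φ : X ⟶ I.cocomplex.X 0)
    (hφ : φ ≫ I.cocomplex.d 0 1 = 0) (h : I.extMk φ 1 rfl hφ = 0) : φ = 0 := by
  rw [← I.extEquivCohomologyClass.apply_eq_iff_eq,
    InjectiveResolution.extEquivCohomologyClass_extMk,
    InjectiveResolution.extEquivCohomologyClass_zero,
    CochainComplex.HomComplex.CohomologyClass.mk_eq_zero_iff,
    CochainComplex.HomComplex.Cocycle.fromSingleMk_mem_coboundaries_iff _ _ _ _ _ (-1) (by simp)]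
    at h
  obtain ⟨g, hg⟩ := h
  have hz : g = 0 := (CochainComplex.isZero_of_isStrictlyGE I.cochainComplex 0 (-1)
    (by lia)).eq_of_tgt _ _
  rw [hz, Limits.zero_comp] at hg
  rw [← cancel_mono (I.cochainComplexXIso ((0 : ℕ) : ℤ) 0 rfl).inv, ← hg, Limits.zero_comp]

/-- Cocycles with the same class in `Ext^n_R(R/𝔞, M)` induce the same map. -/
lemma cocycleMap_congr {R : Type u} [CommRing R] (a : Ideal R) {M : ModuleCat.{u} R}
    (I : InjectiveResolution M) (n : ℕ) (φ ψ : quotientModule a ⟶ I.cocomplex.X n)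
    (hφ : φ ≫ I.cocomplex.d n (n + 1) = 0) (hψ : ψ ≫ I.cocomplex.d n (n + 1) = 0)
    (h : I.extMk φ (n + 1) rfl hφ = I.extMk ψ (n + 1) rfl hψ) :
    cocycleMap a I n φ hφ = cocycleMap a I n ψ hψ := by
  have hd : (φ - ψ) ≫ I.cocomplex.d n (n + 1) = 0 := by
    rw [Preadditive.sub_comp, hφ, hψ, sub_zero]
  have h0 : I.extMk (φ - ψ) (n + 1) rfl hd = 0 := by
    rw [← I.sub_extMk φ ψ (n + 1) rfl hφ hψ, h, sub_self]
  have key : cocycleMap a I n (φ - ψ) hd = 0 := by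
    cases n with
    | zero =>
      have hz := extMk_zero_degree_eq_zero I (φ - ψ) hd h0
      have hadd := cocycleMap_add a I 0 (φ - ψ) (φ - ψ) hd hd (by simp [hz])
      have hc : cocycleMap a I 0 ((φ - ψ) + (φ - ψ)) (by simp [hz]) =
          cocycleMap a I 0 (φ - ψ) hd := by
        congr 1
        simp [hz]
      rw [hc] at hadd
      simpa using hadd
    | succ p =>
      obtain ⟨g, hg⟩ := (I.extMk_eq_zero_iff (φ - ψ) (p + 1 + 1) rfl hd p rfl).1 h0
      have := cocycleMap_boundary a I p g (by rw [hg]; exact hd)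
      simpa only [hg] using this
  have hadd := cocycleMap_add a I n (φ - ψ) ψ hd hψ (by simpa using hφ)
  rw [key, zero_add] at hadd
  rw [← hadd]
  congr 1
  simp

lemma smul_extMk {R : Type u} [CommRing R] {M X : ModuleCat.{u} R} (I : InjectiveResolution M)
    (n : ℕ) (r : R) (φ : X ⟶ I.cocomplex.X n) (hφ : φ ≫ I.cocomplex.d n (n + 1) = 0)
    (h : (r • φ) ≫ I.cocomplex.d n (n + 1) = 0) :
    r • I.extMk φ (n + 1) rfl hφ = I.extMk (r • φ) (n + 1) rfl h := by
  let F : InjectiveResolution.Hom I I (r • 𝟙 M) :=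
    { hom := r • 𝟙 I.cocomplex
      ι_f_zero_comp_hom_f_zero := by
        simp only [HomologicalComplex.smul_f_apply, HomologicalComplex.id_f,
          CochainComplex.single₀_map_f_zero]
        rw [Linear.comp_smul, Category.comp_id]
        exact ((Linear.smul_comp _ _ _ r (𝟙 M) (I.ι.f 0)).trans
          (congrArg (r • ·) (Category.id_comp _))).symm }
  rw [CategoryTheory.Abelian.Ext.smul_eq_comp_mk₀, InjectiveResolution.extMk_comp_mk₀ φ _ _ hφ F]
  have hF : φ ≫ F.hom.f n = r • φ := by
    change φ ≫ (r • 𝟙 (I.cocomplex.X n)) = r • φ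
    rw [Linear.comp_smul, Category.comp_id]
  simp only [hF]

/-- A chosen homomorphism `φ : R/𝔞 → I^n` with `d ∘ φ = 0` that represents a class in
`Ext^n_R(R/𝔞, M)`, where `I` is an injective resolution of `M`. -/
def representative {R : Type u} [CommRing R] (a : Ideal R) {M : ModuleCat.{u} R}
    (I : InjectiveResolution M) (n : ℕ) (e : Ext (quotientModule a) M n) :
    quotientModule a ⟶ I.cocomplex.X n :=
  (I.extMk_surjective e (n + 1) rfl).choose

lemma representative_d {R : Type u} [CommRing R] (a : Ideal R) {M : ModuleCat.{u} R}
    (I : InjectiveResolution M) (n : ℕ) (e : Ext (quotientModule a) M n) :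
    representative a I n e ≫ I.cocomplex.d n (n + 1) = 0 :=
  (I.extMk_surjective e (n + 1) rfl).choose_spec.choose

lemma extMk_representative {R : Type u} [CommRing R] (a : Ideal R) {M : ModuleCat.{u} R}
    (I : InjectiveResolution M) (n : ℕ) (e : Ext (quotientModule a) M n) :
    I.extMk (representative a I n e) (n + 1) rfl (representative_d a I n e) = e :=
  (I.extMk_surjective e (n + 1) rfl).choose_spec.choose_spec

/-- The natural homomorphism `f : Ext^n_R(R/𝔞, M) → Hom_R(R/𝔞, H^n_𝔞(M))`. Let `I` be an injective
resolution of `M`. A class `e` in `Ext^n_R(R/𝔞, M) = H^n(Hom_R(R/𝔞, I))` is represented by a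
homomorphism `φ : R/𝔞 → I^n` with `d ∘ φ = 0`, and `f(e)` sends `x` to the class of `φ(x)` in
`H^n(Γ_𝔞(I)) = H^n_𝔞(M)`. It depends neither on `φ` nor on `I`, see `naturalMap_extMk`. -/
def naturalMap {R : Type u} [CommRing R] (a : Ideal R) (n : ℕ) (M : ModuleCat.{u} R) :
    Ext (quotientModule a) M n →ₗ[R] ((R ⧸ a) →ₗ[R] localCohomologyModule a n M) where
  toFun e :=
    (cocycleMap a (injectiveResolution M) n (representative a (injectiveResolution M) n e)
      (representative_d a (injectiveResolution M) n e)).hom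
  map_add' e₁ e₂ := by
    have h₁ := representative_d a (injectiveResolution M) n e₁
    have h₂ := representative_d a (injectiveResolution M) n e₂
    have h : (representative a (injectiveResolution M) n e₁ +
        representative a (injectiveResolution M) n e₂) ≫
        (injectiveResolution M).cocomplex.d n (n + 1) = 0 := by
      rw [Preadditive.add_comp, h₁, h₂, add_zero]
    rw [← ModuleCat.hom_add, ← cocycleMap_add _ _ _ _ _ h₁ h₂ h]
    congr 1
    apply cocycleMap_congr
    rw [extMk_representative, ← InjectiveResolution.add_extMk _ _ _ _ _ h₁ h₂,
      extMk_representative, extMk_representative]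
  map_smul' r e := by
    have h₁ := representative_d a (injectiveResolution M) n e
    have h : (r • representative a (injectiveResolution M) n e) ≫
        (injectiveResolution M).cocomplex.d n (n + 1) = 0 := by
      rw [Linear.smul_comp, h₁, smul_zero]
    rw [RingHom.id_apply, ← ModuleCat.hom_smul, ← cocycleMap_smul _ _ _ _ _ h₁ h]
    congr 1
    apply cocycleMap_congr
    rw [extMk_representative, ← smul_extMk _ _ _ _ h₁, extMk_representative]

lemma cocycleMap_naturality {R : Type u} [CommRing R] (a : Ideal R) {M N : ModuleCat.{u} R}
    (g : M ⟶ N) (I : InjectiveResolution M) (J : InjectiveResolution N)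
    (F : InjectiveResolution.Hom I J g) (n : ℕ)
    (φ : quotientModule a ⟶ I.cocomplex.X n) (hφ : φ ≫ I.cocomplex.d n (n + 1) = 0)
    (h : (φ ≫ F.hom.f n) ≫ J.cocomplex.d n (n + 1) = 0) :
    cocycleMap a I n φ hφ ≫ ((torsionFunctor a).rightDerived n).map g =
      cocycleMap a J n (φ ≫ F.hom.f n) h := by
  have hF : I.ι.f 0 ≫ F.hom.f 0 = g ≫ J.ι.f 0 := by
    have := F.ι_f_zero_comp_hom_f_zero
    rwa [CochainComplex.single₀_map_f_zero] at this
  have hn : (localCohomologyIso a I n).inv ≫ ((torsionFunctor a).rightDerived n).map g =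
      HomologicalComplex.homologyMap
        (((torsionFunctor a).mapHomologicalComplex (ComplexShape.up ℕ)).map F.hom) n ≫
      (localCohomologyIso a J n).inv :=
    InjectiveResolution.isoRightDerivedObj_inv_naturality g I J F.hom hF (torsionFunctor a) n
  unfold cocycleMap
  rw [Category.assoc, hn, ← Category.assoc]
  congr 1
  rw [Category.assoc, HomologicalComplex.homologyπ_naturality, ← Category.assoc]
  congr 1
  rw [← cancel_mono (HomologicalComplex.iCycles _ n), Category.assoc,
    HomologicalComplex.cyclesMap_i, ← Category.assoc, HomologicalComplex.liftCycles_i,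
    HomologicalComplex.liftCycles_i]
  rfl

/-- The natural map can be computed with every injective resolution `I` of `M` and every
representative `φ`. -/
theorem naturalMap_extMk {R : Type u} [CommRing R] (a : Ideal R) (n : ℕ) {M : ModuleCat.{u} R}
    (I : InjectiveResolution M) (φ : quotientModule a ⟶ I.cocomplex.X n)
    (hφ : φ ≫ I.cocomplex.d n (n + 1) = 0) :
    naturalMap a n M (I.extMk φ (n + 1) rfl hφ) = (cocycleMap a I n φ hφ).hom := by
  let F : InjectiveResolution.Hom I (injectiveResolution M) (𝟙 M) :=
    { hom := InjectiveResolution.desc (𝟙 M) (injectiveResolution M) I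
      ι_f_zero_comp_hom_f_zero := by
        rw [CochainComplex.single₀_map_f_zero]
        exact InjectiveResolution.desc_commutes_zero _ _ _ }
  have h : (φ ≫ F.hom.f n) ≫ (injectiveResolution M).cocomplex.d n (n + 1) = 0 := by
    rw [Category.assoc, F.hom.comm, ← Category.assoc, hφ, Limits.zero_comp]
  have h1 := cocycleMap_naturality a (𝟙 M) I (injectiveResolution M) F n φ hφ h
  have h2 := InjectiveResolution.extMk_comp_mk₀ φ (n + 1) rfl hφ F
  rw [CategoryTheory.Abelian.Ext.comp_mk₀_id] at h2
  rw [CategoryTheory.Functor.map_id] at h1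
  erw [Category.comp_id] at h1
  rw [h1]
  refine congrArg ModuleCat.Hom.hom (cocycleMap_congr a _ n _ _
    (representative_d a (injectiveResolution M) n _) h ?_)
  rw [extMk_representative, h2]

end

end LocalCoh

/-! Write `X = R/𝔞` and `K = Γ_𝔞(I)` for an injective resolution `I` of `M`. Maps out of `X` land in
torsion, so `Hom(X, I) = Hom(X, K)`, and `f` becomes the map `H^n(Hom(X, K)) → Hom(X, H^n(K))` given
by composing cocycles `X → Z^n` with `Z^n → H^n`. Over a noetherian ring the terms of `K` are again
injective (`injective_torsion`), so they have no higher Ext.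

The rest holds for any complex `K` whose terms have no higher Ext from `X`. Lifting `X → H^n` to
`Z^n` is obstructed in `Ext^1(X, B^n)`. A cocycle with zero class lands in `B^n`, and lifting it to
`K^(n-1)` is obstructed in `Ext^1(X, Z^(n-1))`. Both groups vanish by dimension shifting along `0 →
B^i → Z^i → H^i → 0` and `0 → Z^i → K^i → B^(i+1) → 0`, starting from `B^0 = 0`
(`subsingleton_ext_boundaries`). -/

namespace LocalCoh

/-! ### Torsion submodules of injective modules -/

section Torsion

variable {R : Type u} [CommRing R] (a : Ideal R)

/-- Each of finitely many generators has its own exponent, and the largest one works for all. -/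
lemma exists_pow_smul_eq_zero_of_fg {N : Type u} [AddCommGroup N] [Module R N]
    (P : Submodule R N) (hP : P.FG) (h : P ≤ torsion a N) :
    ∃ k : ℕ, ∀ r ∈ a ^ k, ∀ x ∈ P, r • x = 0 := by
  induction P, hP using Submodule.fg_induction with
  | singleton x =>
    obtain ⟨k, hk⟩ := h (Submodule.mem_span_singleton_self x)
    refine ⟨k, fun r hr y hy => ?_⟩
    obtain ⟨c, rfl⟩ := Submodule.mem_span_singleton.1 hy
    rw [smul_comm, hk r hr, smul_zero]
  | sup P Q _ _ ihP ihQ =>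
    obtain ⟨k, hk⟩ := ihP (le_sup_left.trans h)
    obtain ⟨l, hl⟩ := ihQ (le_sup_right.trans h)
    refine ⟨max k l, fun r hr y hy => ?_⟩
    obtain ⟨p, hp, q, hq, rfl⟩ := Submodule.mem_sup.1 hy
    rw [smul_add, hk r (Ideal.pow_le_pow_right (le_max_left k l) hr) p hp,
      hl r (Ideal.pow_le_pow_right (le_max_right k l) hr) q hq, add_zero]

/-- A consequence of the Artin–Rees lemma for ideals. -/
lemma exists_pow_inf_le_pow_mul [IsNoetherianRing R] (b : Ideal R) (k : ℕ) :
    ∃ m : ℕ, a ^ m ⊓ b ≤ a ^ k * b := by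
  obtain ⟨c, hc⟩ := Ideal.exists_pow_inf_eq_pow_smul a (M := R) b
  -- With `c` the Artin–Rees constant, `a ^ (k + c) ⊓ b = a ^ k * (a ^ c ⊓ b)`.
  refine ⟨k + c, ?_⟩
  have h := hc (k + c) (Nat.le_add_left c k)
  rw [Nat.add_sub_cancel, smul_eq_mul, Ideal.mul_top] at h
  rw [h]
  exact Ideal.mul_mono_right inf_le_right

lemma apply_eq_zero_of_mem_mul {N : Type u} [AddCommGroup N] [Module R N] {b c : Ideal R}
    (g : b →ₗ[R] N) (h : ∀ r ∈ c, ∀ x : b, r • g x = 0) {y : R} (hy : y ∈ c * b)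
    (hyb : y ∈ b) : g ⟨y, hyb⟩ = 0 := by
  suffices c * b ≤ (LinearMap.ker g).map b.subtype by
    obtain ⟨x, hx, rfl⟩ := this hy
    exact hx
  refine Ideal.mul_le.2 fun r hr s hs => ⟨r • ⟨s, hs⟩, ?_, rfl⟩
  exact (map_smul g r ⟨s, hs⟩).trans (h r hr _)

/-- Over a noetherian ring, the torsion submodule of an injective module is injective. -/
theorem injective_torsion [IsNoetherianRing R] (N : Type u) [AddCommGroup N] [Module R N]
    [hN : Module.Injective R N] : Module.Injective R (torsion a N) := by
  -- Baer's criterion. The image of `g` is killed by some `a ^ k`, so by Artin–Rees `g` vanishes on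
  -- some `a ^ m ⊓ b`. It then factors through the image of `b` in `R ⧸ a ^ m`, from which
  -- injectivity of `N` extends it.
  refine Module.Baer.injective fun b g => ?_
  let g' : b →ₗ[R] N := (torsion a N).subtype ∘ₗ g
  obtain ⟨k, hk⟩ := exists_pow_smul_eq_zero_of_fg a (LinearMap.range g')
    (by rw [LinearMap.range_eq_map]; exact (IsNoetherian.noetherian (⊤ : Submodule R b)).map g')
    (by rintro _ ⟨x, rfl⟩; exact (g x).2)
  obtain ⟨m, hm⟩ := exists_pow_inf_le_pow_mul a b k
  let q : b →ₗ[R] R ⧸ (a ^ m) := (a ^ m).mkQ ∘ₗ b.subtype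
  have hq : LinearMap.ker q ≤ LinearMap.ker g' := by
    rintro ⟨x, hx⟩ hxq
    have hxm : x ∈ a ^ m := (Submodule.Quotient.mk_eq_zero _).1 hxq
    exact apply_eq_zero_of_mem_mul g' (fun r hr y => hk r hr _ ⟨y, rfl⟩) (hm ⟨hxm, hx⟩) hx
  obtain ⟨h, hh⟩ := hN.out ((LinearMap.ker q).liftQ q le_rfl)
    (LinearMap.ker_eq_bot.1 (Submodule.ker_liftQ_eq_bot _ _ _ le_rfl))
    ((LinearMap.ker q).liftQ g' hq)
  -- Having passed through `R ⧸ a ^ m`, the extension has values killed by `a ^ m`, hence torsion.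
  have ht : ∀ r : R, (h ∘ₗ (a ^ m).mkQ) r ∈ torsion a N := fun r => by
    refine ⟨m, fun s hs => ?_⟩
    rw [← map_smul, LinearMap.comp_apply, (a ^ m).mkQ_apply,
      (Submodule.Quotient.mk_eq_zero (x := s • r) _).2 (Ideal.mul_mem_right r _ hs), map_zero]
  exact ⟨(h ∘ₗ (a ^ m).mkQ).codRestrict _ ht,
    fun x hx => Subtype.ext (hh (Submodule.Quotient.mk ⟨x, hx⟩))⟩

instance injective_torsionFunctor_obj [IsNoetherianRing R] (N : ModuleCat.{u} R)
    [hN : CategoryTheory.Injective N] :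
    CategoryTheory.Injective ((torsionFunctor a).obj N) := by
  have : Module.Injective R N := (Module.injective_iff_injective_object R N).2 hN
  have := injective_torsion a N
  exact Module.injective_object_of_injective_module R (torsion a N)

end Torsion

/-! ### Dimension shifting through cycles and boundaries of a complex -/

section Complex

open Limits

universe w v t

variable {C : Type t} [Category.{v} C] [Abelian C]

/-- The boundaries `B → Z` of a complex in degree `n`, followed by the projection to homology. -/
noncomputable abbrev boundariesShortComplex (K : CochainComplex C ℕ) (n : ℕ) : ShortComplex C :=
  ShortComplex.mk (kernel.ι (K.homologyπ n)) (K.homologyπ n) (kernel.condition _)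

lemma boundariesShortComplex_shortExact (K : CochainComplex C ℕ) (n : ℕ) :
    (boundariesShortComplex K n).ShortExact :=
  .mk' (ShortComplex.exact_of_f_is_kernel _ (kernelIsKernel _)) inferInstance inferInstance

/-- The differential, as a map onto the boundaries. -/
noncomputable def toBoundaries (K : CochainComplex C ℕ) (n : ℕ) :
    K.X n ⟶ kernel (K.homologyπ (n + 1)) :=
  kernel.lift _ (K.toCycles n (n + 1)) (K.toCycles_comp_homologyπ n (n + 1))

lemma toBoundaries_ι_iCycles (K : CochainComplex C ℕ) (n : ℕ) :
    toBoundaries K n ≫ kernel.ι (K.homologyπ (n + 1)) ≫ K.iCycles (n + 1) = K.d n (n + 1) := by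
  simp [toBoundaries]

/-- The cycles in degree `n`, mapped to all cochains, mapped onto the boundaries in degree
`n + 1`. -/
noncomputable abbrev cyclesShortComplex (K : CochainComplex C ℕ) (n : ℕ) : ShortComplex C :=
  ShortComplex.mk (K.iCycles n) (toBoundaries K n) (by
    rw [← cancel_mono (kernel.ι (K.homologyπ (n + 1))), ← cancel_mono (K.iCycles (n + 1))]
    simp [toBoundaries])

lemma cyclesShortComplex_shortExact (K : CochainComplex C ℕ) (n : ℕ) :
    (cyclesShortComplex K n).ShortExact := by
  refine .mk' (ShortComplex.exact_of_f_is_kernel _ ?_) inferInstance ?_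
  · refine KernelFork.IsLimit.ofι' _ _ fun {A} k hk => ?_
    refine ⟨K.liftCycles k (n + 1) (by simp) ?_, K.liftCycles_i _ _ _ _⟩
    rw [← toBoundaries_ι_iCycles, reassoc_of% hk, zero_comp]
  -- Homology is the cokernel of `K^n → Z^(n+1)`, so this map covers the kernel of `homologyπ`.
  · have h : (ShortComplex.mk (K.toCycles n (n + 1)) (K.homologyπ (n + 1)) (by simp)).Exact :=
      ShortComplex.exact_of_g_is_cokernel _ (K.homologyIsCokernel n (n + 1) (by simp))
    exact (ShortComplex.exact_iff_epi_kernel_lift _).1 h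

/-- No nonzero differential enters degree `0`, so `homologyπ` is mono there. -/
lemma kernel_homologyπ_zero_isZero (K : CochainComplex C ℕ) : IsZero (kernel (K.homologyπ 0)) :=
  isZero_kernel_of_mono _

variable [HasExt.{w} C]

lemma subsingleton_ext_X₂ {S : ShortComplex C} (hS : S.ShortExact) (X : C) (n : ℕ)
    (h₁ : Subsingleton (Ext X S.X₁ n)) (h₃ : Subsingleton (Ext X S.X₃ n)) :
    Subsingleton (Ext X S.X₂ n) := by
  refine subsingleton_of_forall_eq 0 fun x => ?_
  obtain ⟨y, rfl⟩ := Ext.covariant_sequence_exact₂ X hS x (Subsingleton.elim _ _)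
  rw [Subsingleton.elim y 0, Ext.zero_comp]

lemma subsingleton_ext_X₃ {S : ShortComplex C} (hS : S.ShortExact) (X : C) (n : ℕ)
    (h₂ : Subsingleton (Ext X S.X₂ n)) (h₁ : Subsingleton (Ext X S.X₁ (n + 1))) :
    Subsingleton (Ext X S.X₃ n) := by
  refine subsingleton_of_forall_eq 0 fun x => ?_
  obtain ⟨y, rfl⟩ := Ext.covariant_sequence_exact₃ X hS x rfl (Subsingleton.elim _ _)
  rw [Subsingleton.elim y 0, Ext.zero_comp]

/-- The obstruction to lifting `g` is its image under the connecting map to `Ext^1(X, S.X₁)`. -/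
lemma exists_lift_of_subsingleton_ext {S : ShortComplex C} (hS : S.ShortExact) {X : C}
    (h₁ : Subsingleton (Ext X S.X₁ 1)) (g : X ⟶ S.X₃) : ∃ l : X ⟶ S.X₂, l ≫ S.g = g := by
  obtain ⟨y, hy⟩ := Ext.covariant_sequence_exact₃ X hS (Ext.mk₀ g) (zero_add 1)
    (Subsingleton.elim _ _)
  obtain ⟨l, rfl⟩ := (Ext.mk₀_bijective X S.X₂).2 y
  rw [Ext.mk₀_comp_mk₀] at hy
  exact ⟨l, (Ext.mk₀_bijective X S.X₃).1 hy⟩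

lemma subsingleton_ext_of_iso {X Y Z : C} (e : Y ≅ Z) (n : ℕ) (h : Subsingleton (Ext X Y n)) :
    Subsingleton (Ext X Z n) := by
  refine subsingleton_of_forall_eq 0 fun x => ?_
  rw [← x.comp_mk₀_id, ← e.inv_hom_id, ← Ext.mk₀_comp_mk₀,
    ← Ext.comp_assoc_of_third_deg_zero, Subsingleton.elim (x.comp (Ext.mk₀ e.inv) _) 0,
    Ext.zero_comp]

variable {X : C} {K : CochainComplex C ℕ} (hK : ∀ i k, Subsingleton (Ext X (K.X i) (k + 1)))
include hK

/-- The vanishing of `Ext^(m - j)(X, H^j(K))` for all `j < i` propagates to the boundaries of `K`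
in degree `i`. -/
lemma subsingleton_ext_boundaries (m i : ℕ) (hi : i < m)
    (h : ∀ j < i, Subsingleton (Ext X (K.homology j) (m - j))) :
    Subsingleton (Ext X (kernel (K.homologyπ i)) (m - i)) := by
  induction i with
  | zero =>
    exact subsingleton_of_forall_eq 0 fun x => by
      rw [← x.comp_mk₀_id, (kernel_homologyπ_zero_isZero K).eq_of_src (𝟙 _) 0, Ext.mk₀_zero,
        Ext.comp_zero]
  | succ i ih =>
    have hB := ih (by lia) fun j hj => h j (by lia)
    have hZ := subsingleton_ext_X₂ (boundariesShortComplex_shortExact K i) X _ hB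
      (h i (by lia))
    -- The bound `i + 1 < m` makes the new exponent `m - (i + 1) = k + 1` positive, as needed for
    -- the Ext of `K.X i` to vanish, and removes the truncated subtraction.
    obtain ⟨k, rfl⟩ : ∃ k, m = i + 1 + (k + 1) := ⟨m - i - 2, by lia⟩
    rw [show i + 1 + (k + 1) - i = k + 1 + 1 by lia] at hZ
    rw [show i + 1 + (k + 1) - (i + 1) = k + 1 by lia]
    exact subsingleton_ext_X₃ (cyclesShortComplex_shortExact K i) X _ (hK i k) hZ

/-- Since `z` factors through `B^(n+1)`, only a lift along `K^n → B^(n+1)` is needed. Its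
obstruction group `Ext^1(X, Z^n)` sits between those of `B^n` and `H^n`. -/
lemma exists_boundary_of_homology_eq_zero (n : ℕ)
    (h : ∀ j < n + 1, Subsingleton (Ext X (K.homology j) (n + 1 - j)))
    (z : X ⟶ K.cycles (n + 1)) (hz : z ≫ K.homologyπ (n + 1) = 0) :
    ∃ g : X ⟶ K.X n, g ≫ K.d n (n + 1) = z ≫ K.iCycles (n + 1) := by
  have hB := subsingleton_ext_boundaries hK (n + 1) n (by lia) fun j hj => h j (by lia)
  have hZ := subsingleton_ext_X₂ (boundariesShortComplex_shortExact K n) X _ hB (h n (by lia))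
  rw [show n + 1 - n = 1 by lia] at hZ
  obtain ⟨g, hg⟩ := exists_lift_of_subsingleton_ext (cyclesShortComplex_shortExact K n) hZ
    (kernel.lift _ z hz)
  refine ⟨g, ?_⟩
  rw [← toBoundaries_ι_iCycles, reassoc_of% hg, kernel.lift_ι_assoc]

/-- The obstruction lies in `Ext^1(X, B^n)`, the case `m = n + 1`, `i = n` of the dimension shift.
-/
lemma exists_lift_cycles (n : ℕ)
    (h : ∀ j < n, Subsingleton (Ext X (K.homology j) (n + 1 - j))) (g : X ⟶ K.homology n) :
    ∃ z : X ⟶ K.cycles n, z ≫ K.homologyπ n = g := by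
  have hB := subsingleton_ext_boundaries hK (n + 1) n (by lia) h
  rw [show n + 1 - n = 1 by lia] at hB
  exact exists_lift_of_subsingleton_ext (boundariesShortComplex_shortExact K n) hB g

end Complex

/-! ### Injectivity and surjectivity of the natural map -/

section NaturalMap

variable {R : Type u} [CommRing R] (a : Ideal R)

/-- The inclusion `Γ_𝔞(N) → N`. -/
def torsionι (N : ModuleCat.{u} R) : (torsionFunctor a).obj N ⟶ N :=
  ModuleCat.ofHom (torsion a N).subtype

lemma torsionι_naturality {N P : ModuleCat.{u} R} (g : N ⟶ P) :
    (torsionFunctor a).map g ≫ torsionι a P = torsionι a N ≫ g := rfl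

lemma toTorsion_torsionι {N : ModuleCat.{u} R} (φ : quotientModule a ⟶ N) :
    toTorsion a φ ≫ torsionι a N = φ := rfl

variable [IsNoetherianRing R] {M : ModuleCat.{u} R} (I : InjectiveResolution M)

lemma subsingleton_ext_torsionComplex (i k : ℕ) :
    Subsingleton (Ext (quotientModule a) ((torsionComplex a I.cocomplex).X i) (k + 1)) := by
  have : Injective ((torsionComplex a I.cocomplex).X i) :=
    injective_torsionFunctor_obj a (I.cocomplex.X i)
  exact subsingleton_of_forall_eq 0 fun x => x.eq_zero_of_injective

theorem naturalMap_injective (n : ℕ)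
    (h : ∀ j < n, Subsingleton
      (Ext (quotientModule a) (localCohomologyModule a j M) (n - j))) :
    Function.Injective (naturalMap a n M) := by
  let I := injectiveResolution M
  rw [injective_iff_map_eq_zero]
  intro e he
  obtain ⟨φ, hφ, rfl⟩ := I.extMk_surjective e (n + 1) rfl
  rw [naturalMap_extMk] at he
  replace he : cocycleMap a I n φ hφ = 0 := ModuleCat.hom_ext he
  rw [cocycleMap, ← Limits.zero_comp, cancel_mono] at he
  cases n with
  | zero =>
    -- In degree `0` there are no boundaries to find: `homologyπ` is mono, so `φ` itself vanishes.
    rw [← Limits.zero_comp (f := (torsionComplex a I.cocomplex).homologyπ 0), cancel_mono] at he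
    have h0 : toTorsionComplex a I.cocomplex φ = 0 := by
      rw [← (torsionComplex a I.cocomplex).liftCycles_i (toTorsionComplex a I.cocomplex φ) 1
        (by simp) (toTorsionComplex_d_eq_zero a I.cocomplex φ hφ), he, Limits.zero_comp]
    have hφ0 : φ = 0 := by
      rw [← toTorsion_torsionι a φ]
      exact (congrArg (· ≫ torsionι a _) h0).trans Limits.zero_comp
    subst hφ0
    exact I.extMk_zero 1 rfl
  | succ n =>
    obtain ⟨g, hg⟩ := exists_boundary_of_homology_eq_zero
      (subsingleton_ext_torsionComplex a I) n
      (fun j hj => subsingleton_ext_of_iso (localCohomologyIso a I j) _ (h j hj)) _ he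
    rw [HomologicalComplex.liftCycles_i] at hg
    -- A primitive of `φ` in `Γ_𝔞(I)` is also one in `I` after inclusion.
    refine (I.extMk_eq_zero_iff φ _ rfl hφ n rfl).2 ⟨g ≫ torsionι a _, ?_⟩
    exact congrArg (· ≫ torsionι a _) hg

theorem naturalMap_surjective (n : ℕ)
    (h : ∀ j < n, Subsingleton
      (Ext (quotientModule a) (localCohomologyModule a j M) (n + 1 - j))) :
    Function.Surjective (naturalMap a n M) := by
  let I := injectiveResolution M
  intro g
  obtain ⟨z, hz⟩ := exists_lift_cycles (subsingleton_ext_torsionComplex a I) n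
    (fun j hj => subsingleton_ext_of_iso (localCohomologyIso a I j) _ (h j hj))
    (ModuleCat.ofHom g ≫ (localCohomologyIso a I n).hom)
  -- The lifted cocycle, viewed in `Γ_𝔞(I^n)`; its inclusion into `I^n` represents the preimage of
  -- `g`.
  let ψ : quotientModule a ⟶ (torsionFunctor a).obj (I.cocomplex.X n) :=
    z ≫ (torsionComplex a I.cocomplex).iCycles n
  have hψ : ψ ≫ (torsionFunctor a).map (I.cocomplex.d n (n + 1)) = 0 := by
    have : (z ≫ (torsionComplex a I.cocomplex).iCycles n) ≫
        (torsionComplex a I.cocomplex).d n (n + 1) = 0 := by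
      rw [Category.assoc, HomologicalComplex.iCycles_d, Limits.comp_zero]
    exact this
  have hφ : (ψ ≫ torsionι a _) ≫ I.cocomplex.d n (n + 1) = 0 := by
    rw [Category.assoc, ← torsionι_naturality, reassoc_of% hψ, Limits.zero_comp]
  refine ⟨I.extMk (ψ ≫ torsionι a _) (n + 1) rfl hφ, ?_⟩
  rw [naturalMap_extMk]
  -- Including into `I^n` and corestricting to torsion again gives back `z`.
  have hl : (torsionComplex a I.cocomplex).liftCycles
      (toTorsionComplex a I.cocomplex (ψ ≫ torsionι a _)) (n + 1) (by simp)
      (toTorsionComplex_d_eq_zero a I.cocomplex _ hφ) = z := by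
    rw [← cancel_mono (HomologicalComplex.iCycles _ n), HomologicalComplex.liftCycles_i]
    rfl
  rw [cocycleMap, hl, hz, Category.assoc, Iso.hom_inv_id, Category.comp_id, ModuleCat.hom_ofHom]

end NaturalMap

end LocalCoh

theorem corollary2p2 {R : Type u} [CommRing R] [IsNoetherianRing R] (a : Ideal R)
    (M : ModuleCat.{u} R) (n : ℕ) :
    ((∀ j < n, Subsingleton
        (Ext (LocalCoh.quotientModule a) (LocalCoh.localCohomologyModule a j M) (n - j))) →
      Function.Injective (LocalCoh.naturalMap a n M)) ∧
    ((∀ j < n, Subsingleton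
        (Ext (LocalCoh.quotientModule a) (LocalCoh.localCohomologyModule a j M) (n + 1 - j))) →
      Function.Surjective (LocalCoh.naturalMap a n M)) ∧
    ((∀ t ∈ ({n, n + 1} : Set ℕ), ∀ j < n, Subsingleton
        (Ext (LocalCoh.quotientModule a) (LocalCoh.localCohomologyModule a j M) (t - j))) →
      Function.Bijective (LocalCoh.naturalMap a n M)) := by
  refine ⟨LocalCoh.naturalMap_injective a n, LocalCoh.naturalMap_surjective a n, fun h => ?_⟩
  exact ⟨LocalCoh.naturalMap_injective a n (h n (by simp)),
    LocalCoh.naturalMap_surjective a n (h (n + 1) (by simp))⟩
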